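/- Let $\mathbb D=\{|z|<1\}$ and $\mathbb C_+=\{\operatorname{Im}\lambda>0\}$. A Carathéodory function is a holomorphic $F$ on $\mathbb D$ with $F(0)=1$ and $\operatorname{Re}F>0$; a Nevanlinna function is a holomorphic $\varphi$ on $\mathbb C_+$ with $\operatorname{Im}\varphi>0$. The Schur parameters of $F$ are those of the function $f$ given by $F(z)=\frac{1+zf(z)}{1-zf(z)}$, that is, $\gamma_n=f_n(0)$, where $f_0=f$ and $f_n(z)=\frac{\gamma_n+zf_{n+1}(z)}{1+\overline{\gamma}_nzf_{n+1}(z)}$; it is assumed that the algorithm does not terminate, i.e. $|\gamma_n|<1$ for all $n\ge 0$. Given $(\gamma_n)$, put $$\delta_0=1,\quad \delta_{n+1}=\frac{\overline\gamma_n-\delta_n}{1-\gamma_n\delta_n},\quad g_{n+1}=\frac{|1-\gamma_n\delta_n|^2}{2\operatorname{Re}(1-\gamma_n\delta_n)},\quad r_{n+1}=-\frac{\operatorname{Im}(1-\gamma_n\delta_n)}{\operatorname{Re}(1-\gamma_n\delta_n)}\qquad(n\ge 0).$$ For real sequences $(g_k)_{k\ge1}$, $(r_k)_{k\ge1}$ consider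 the continued fraction $$(*)\qquad \cfrac{-1}{\lambda-\cfrac{g_1(\lambda^2+1)}{\lambda-r_1-\cfrac{(1-g_1)g_2(\lambda^2+1)}{\lambda-r_2-\cfrac{(1-g_2)g_3(\lambda^2+1)}{\lambda-r_3-\cdots}}}}.$$ We say that $(*)$ represents $\varphi$ if the denominators of all its approximants have no zeros in $\mathbb C_+$ and the approximants converge to $\varphi$ locally uniformly in $\mathbb C_+$. **Theorem (Wall).** (1) Let $F$ be a Carathéodory function with Schur parameters $\gamma_0,\gamma_1,\gamma_2,\dots$, and let $g_k,r_k$ be defined from them as above. Then $0<g_k<1$ for all $k\ge1$, and the function $\varphi(\lambda)=iF\left(\frac{i-\lambda}{i+\lambda}\right)$ is a Nevanlinna function represented by $(*)$. (2) Conversely, for any sequences $(g_k)_{k\ge1}$, $(r_k)_{k\ge1}$ of real numbers with $0<g_k<1$, the fraction $(*)$ represents a Nevanlinna function $\varphi$ with $\varphi(i)=i$. Moreover $\varphi(\lambda)=iF\left(\frac{i-\lambda}{i+\lambda}\right)$ for a Carathéodory function $F$ whose Schur algorithm does not terminate, and the given $g_k,r_k$ are the numbers defined above from the Schur parameters $\gamma_k$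 of $F$. (3) In both cases the Schur parameters are recovered from $(g_k,r_k)$ as follows: for $k\ge 0$, $$u_k:=1-\gamma_k\delta_k=\frac{2g_{k+1}}{1+r_{k+1}^2}-\frac{2g_{k+1}r_{k+1}}{1+r_{k+1}^2}\,i,$$ $$\gamma_0=1-u_0,\qquad \gamma_{k+1}=(-1)^{k+1}\,\frac{u_0u_1\cdots u_k}{\overline u_0\,\overline u_1\cdots\overline u_k}\,(1-u_{k+1}).$$ -/

import Mathlib

open Filter Topology ComplexConjugate

noncomputable section

namespace WallCF

/-- The open unit disc in the complex plane. -/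
def unitDisc : Set ℂ := Metric.ball 0 1

/-- The open upper half-plane. -/
def upperHalf : Set ℂ := {w : ℂ | 0 < w.im}

/-- Carathéodory functions: holomorphic on the unit disc, `F 0 = 1`, positive real part. -/
def IsCaratheodory (F : ℂ → ℂ) : Prop :=
  DifferentiableOn ℂ F unitDisc ∧ F 0 = 1 ∧ ∀ z ∈ unitDisc, 0 < (F z).re

/-- Nevanlinna functions: holomorphic on the upper half-plane, positive imaginary part. -/
def IsNevanlinna (φ : ℂ → ℂ) : Prop :=
  DifferentiableOn ℂ φ upperHalf ∧ ∀ w ∈ upperHalf, 0 < (φ w).im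

/-- The function `f` with `F z = (1 + z f z) / (1 - z f z)`, that is,
`f z = z⁻¹ (F z - 1) / (F z + 1)`, with the removable singularity at `0` filled in by the
derivative (`dslope`); here `F 0 = 1`. -/
def schurFunction (F : ℂ → ℂ) : ℂ → ℂ :=
  dslope (fun z => (F z - 1) / (F z + 1)) 0

/-- One step of the Schur algorithm: with `γ = f 0`, the function `f₁` for which
`f z = (γ + z f₁ z) / (1 + conj γ z f₁ z)`, that is,
`f₁ z = z⁻¹ (f z - γ) / (1 - conj γ f z)`, with the removable singularity at `0` filled in. -/
def schurStep (f : ℂ → ℂ) : ℂ → ℂ :=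
  dslope (fun z => (f z - f 0) / (1 - conj (f 0) * f z)) 0

/-- The iterates `f₀ = f, f₁, f₂, …` of the Schur algorithm. -/
def schurIterate (f : ℂ → ℂ) : ℕ → ℂ → ℂ
  | 0 => f
  | n + 1 => schurStep (schurIterate f n)

/-- `γ₀, γ₁, γ₂, …` is the (infinite) sequence of Schur parameters of the Carathéodory
function `F`: the Schur algorithm applied to the Schur function of `F` does not terminate
(`‖γ n‖ < 1` for every `n`) and `γ n = fₙ 0`. -/
def HasSchurParameters (F : ℂ → ℂ) (γ : ℕ → ℂ) : Prop :=
  ∀ n, ‖γ n‖ < 1 ∧ γ n = schurIterate (schurFunction F) n 0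

/-- The function `w ↦ i F ((i - w) / (i + w))`. -/
def cayley (F : ℂ → ℂ) (w : ℂ) : ℂ :=
  Complex.I * F ((Complex.I - w) / (Complex.I + w))

/-- `δ₀ = 1`, `δ_{n+1} = (conj γ_n - δ_n) / (1 - γ_n δ_n)`. -/
def delta (γ : ℕ → ℂ) : ℕ → ℂ
  | 0 => 1
  | n + 1 => (conj (γ n) - delta γ n) / (1 - γ n * delta γ n)

/-- `wallG γ (n+1) = |1 - γ_n δ_n|² / (2 Re (1 - γ_n δ_n))`; the value at `0` is a dummy. -/
def wallG (γ : ℕ → ℂ) : ℕ → ℝ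
  | 0 => 0
  | n + 1 => ‖1 - γ n * delta γ n‖ ^ 2 / (2 * (1 - γ n * delta γ n).re)

/-- `wallR γ (n+1) = - Im (1 - γ_n δ_n) / Re (1 - γ_n δ_n)`; the value at `0` is a dummy. -/
def wallR (γ : ℕ → ℂ) : ℕ → ℝ
  | 0 => 0
  | n + 1 => -((1 - γ n * delta γ n).im / (1 - γ n * delta γ n).re)

/-- The pairs (partial numerator, partial denominator) of the fraction
`- 1/w - g₁(w²+1)/(w - r₁) - (1 - g₁)g₂(w²+1)/(w - r₂) - …`.
Only the values `g k`, `r k` with `1 ≤ k` are used. -/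
def wallPair (g r : ℕ → ℝ) (w : ℂ) : ℕ → GenContFract.Pair ℂ
  | 0 => ⟨-1, w⟩
  | 1 => ⟨-((g 1 : ℂ) * (w ^ 2 + 1)), w - (r 1 : ℂ)⟩
  | k + 2 => ⟨-((1 - (g (k + 1) : ℂ)) * (g (k + 2) : ℂ) * (w ^ 2 + 1)), w - (r (k + 2) : ℂ)⟩

/-- The continued fraction
`- 1/w - g₁(w²+1)/(w - r₁) - (1 - g₁)g₂(w²+1)/(w - r₂) - …`. -/
def wallFraction (g r : ℕ → ℝ) (w : ℂ) : GenContFract ℂ :=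
  ⟨0, Stream'.Seq.ofStream (wallPair g r w)⟩

/-- The continued fraction with coefficients `g`, `r` represents `φ` on the upper half-plane:
all its approximants are well defined there (no denominator vanishes) and they converge
to `φ` locally uniformly. -/
def Represents (g r : ℕ → ℝ) (φ : ℂ → ℂ) : Prop :=
  (∀ n, ∀ w ∈ upperHalf, (wallFraction g r w).dens n ≠ 0) ∧
    TendstoLocallyUniformlyOn (fun (n : ℕ) (w : ℂ) => (wallFraction g r w).convs n) φ
      atTop upperHalf

/-- `u_k = 2 g_{k+1} / (1 + r_{k+1}²) - (2 g_{k+1} r_{k+1} / (1 + r_{k+1}²)) i`. -/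
def recoverU (g r : ℕ → ℝ) (k : ℕ) : ℂ :=
  2 * (g (k + 1) : ℂ) / (1 + (r (k + 1) : ℂ) ^ 2)
    - 2 * (g (k + 1) : ℂ) * (r (k + 1) : ℂ) / (1 + (r (k + 1) : ℂ) ^ 2) * Complex.I

/-- The two-step recovery of the Schur parameters `γ` from `(g, r)`. -/
def RecoveredFrom (γ : ℕ → ℂ) (g r : ℕ → ℝ) : Prop :=
  (∀ k, 1 - γ k * delta γ k = recoverU g r k) ∧
    γ 0 = 1 - recoverU g r 0 ∧
    ∀ k, γ (k + 1) =
      (-1) ^ (k + 1) *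
        ((∏ j ∈ Finset.range (k + 1), recoverU g r j) /
          (∏ j ∈ Finset.range (k + 1), conj (recoverU g r j))) *
        (1 - recoverU g r (k + 1))

end WallCF

end

/-!
Put `z = (i - w) / (i + w)`, let `f_k` be the iterates of the Schur algorithm of `F`, and
`h_k = δ_k f_k(z)`. With `u = 1 - γ_k δ_k = 2 g / (1 + r i)`, where `g = g_{k+1}`, `r = r_{k+1}`,
one step of the Schur algorithm becomes a Möbius relation between `h_k` and `h_{k+1}` with
coefficients in `g` and `r` only (`delta_mul_schurMap`). It says that the numbers
`t_0 = i (1 - z h_0) / (1 + z h_0)` and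
`t_{k+1} = 2 i g_{k+1} (1 + z h_k) / ((1 + z) (1 - h_k))` satisfy the recurrence
of the tails of Wall's fraction (`wallTail_zero_eq`, `wallTail_succ_eq`), and `-1 / t_0 = i F(z)`.

Cutting the fraction off after the pair of index `n` means `h_n = 1`, that is, replacing `f_n` by
the constant `conj δ_n` of modulus one. So the approximants are the Cayley transforms of the
Carathéodory functions with the same first `n` Schur parameters as `F` and a terminating algorithm;
the denominators are products of tails, none of which vanishes for `‖z‖ < 1`
(`wallFraction_dens_convs`).

Convergence is a contraction argument: an inverse Schur step multiplies by `z`, which contracts the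
pseudo-hyperbolic distance on the closed disc by the factor `2 ρ / (1 + ρ²) < 1` if `‖z‖ ≤ ρ < 1`,
and then applies a disc automorphism, which preserves it. Hence the value at `z` is determined by
the first `n` parameters up to a geometrically small error, locally uniformly in `z`
(`norm_schurComp_sub_le`).

The same estimate constructs, for any `γ` with `‖γ n‖ < 1`, a Schur function with these
parameters as a limit of compositions of inverse Schur steps (`exists_hasSchurParameters`). Since
`δ_{k+1} = -δ_k conj u_k / u_k`, and `0 < g < 1` is equivalent to `‖1 - u‖ < 1` for
`u = 2 g / (1 + r i)`, every pair of sequences `g`, `r` arises from such a `γ`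
(`exists_wallG_wallR_eq`), which reduces the converse to the direct statement.
-/

noncomputable section

namespace WallCF

/-! ### Möbius steps of the Schur algorithm -/

/-- The inverse Schur step at the point `z`, as a map of the value `w = f₁ z` to `f z`:
`w ↦ (γ + z w) / (1 + conj γ z w)`. -/
def schurMap (γ z w : ℂ) : ℂ := (γ + z * w) / (1 + conj γ * (z * w))

/-- The composition of the `n` inverse Schur steps with parameters `γ k, …, γ (k + n - 1)`
at the point `z`; it takes the value of `f_{k+n} z` to that of `f_k z`. -/
def schurComp (γ : ℕ → ℂ) (z : ℂ) : ℕ → ℕ → ℂ → ℂ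
  | _, 0, w => w
  | k, n + 1, w => schurMap (γ k) z (schurComp γ z (k + 1) n w)

lemma one_add_ne_zero_of_norm_lt_one {a : ℂ} (ha : ‖a‖ < 1) : 1 + a ≠ 0 := by
  intro h
  rw [← neg_eq_of_add_eq_zero_right h] at ha
  simp at ha

lemma one_sub_ne_zero_of_norm_lt_one {a : ℂ} (ha : ‖a‖ < 1) : 1 - a ≠ 0 := by
  simpa [sub_eq_add_neg] using one_add_ne_zero_of_norm_lt_one (a := -a) (by simpa using ha)

lemma norm_mul_lt_one {a b : ℂ} (ha : ‖a‖ < 1) (hb : ‖b‖ ≤ 1) : ‖a * b‖ < 1 := by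
  rw [norm_mul]
  nlinarith [norm_nonneg a, norm_nonneg b]

lemma one_add_conj_mul_ne_zero {a b : ℂ} (ha : ‖a‖ < 1) (hb : ‖b‖ ≤ 1) :
    1 + conj a * b ≠ 0 :=
  one_add_ne_zero_of_norm_lt_one (norm_mul_lt_one (by simpa using ha) hb)

lemma one_sub_conj_mul_ne_zero {a b : ℂ} (ha : ‖a‖ < 1) (hb : ‖b‖ ≤ 1) :
    1 - conj a * b ≠ 0 :=
  one_sub_ne_zero_of_norm_lt_one (norm_mul_lt_one (by simpa using ha) hb)

lemma norm_one_sub_conj_mul_sq_sub (a b : ℂ) :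
    ‖1 - conj a * b‖ ^ 2 - ‖a - b‖ ^ 2 = (1 - ‖a‖ ^ 2) * (1 - ‖b‖ ^ 2) := by
  simp only [Complex.sq_norm, Complex.normSq_apply, Complex.sub_re, Complex.sub_im,
    Complex.mul_re, Complex.mul_im, Complex.conj_re, Complex.conj_im, Complex.one_re,
    Complex.one_im]
  ring

lemma norm_sub_le_norm_one_sub_conj_mul {a b : ℂ} (ha : ‖a‖ ≤ 1) (hb : ‖b‖ ≤ 1) :
    ‖a - b‖ ≤ ‖1 - conj a * b‖ := by
  have h := norm_one_sub_conj_mul_sq_sub a b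
  have h1 : 0 ≤ (1 - ‖a‖ ^ 2) * (1 - ‖b‖ ^ 2) :=
    mul_nonneg (by nlinarith [norm_nonneg a]) (by nlinarith [norm_nonneg b])
  exact le_of_sq_le_sq (by linarith) (norm_nonneg _)

lemma norm_schurMap_lt_one {γ z w : ℂ} (hγ : ‖γ‖ < 1) (hz : ‖z‖ < 1) (hw : ‖w‖ ≤ 1) :
    ‖schurMap γ z w‖ < 1 := by
  have hzw := norm_mul_lt_one hz hw
  have h0 := one_add_conj_mul_ne_zero hγ hzw.le
  rw [schurMap, norm_div, div_lt_one (norm_pos_iff.2 h0)]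
  have h := norm_one_sub_conj_mul_sq_sub γ (-(z * w))
  simp only [mul_neg, sub_neg_eq_add, norm_neg] at h
  have h1 : 0 < (1 - ‖γ‖ ^ 2) * (1 - ‖z * w‖ ^ 2) :=
    mul_pos (by nlinarith [norm_nonneg γ]) (by nlinarith [norm_nonneg (z * w)])
  exact lt_of_pow_lt_pow_left₀ 2 (norm_nonneg _) (by linarith)

lemma norm_schurComp_le_one {γ : ℕ → ℂ} (hγ : ∀ n, ‖γ n‖ < 1) {z w : ℂ} (hz : ‖z‖ < 1)
    (hw : ‖w‖ ≤ 1) (k n : ℕ) : ‖schurComp γ z k n w‖ ≤ 1 := by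
  induction n generalizing k with
  | zero => exact hw
  | succ n ih => exact (norm_schurMap_lt_one (hγ k) hz (ih (k + 1))).le

lemma schurComp_succ_right (γ : ℕ → ℂ) (z w : ℂ) (k n : ℕ) :
    schurComp γ z k (n + 1) w = schurComp γ z k n (schurMap (γ (k + n)) z w) := by
  induction n generalizing k with
  | zero => rfl
  | succ n ih =>
    rw [schurComp, ih (k + 1), schurComp, show k + 1 + n = k + (n + 1) by ring]

/-! ### Contraction of the pseudo-hyperbolic distance

The pseudo-hyperbolic distance of `a` and `b` is `‖a - b‖ / ‖1 - conj a * b‖`. -/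

/-- The contraction rate of `w ↦ z w` on the unit disc, in the pseudo-hyperbolic distance, for
`‖z‖ ≤ ρ`. -/
def contractionRate (ρ : ℝ) : ℝ := 2 * ρ / (1 + ρ ^ 2)

lemma contractionRate_nonneg {ρ : ℝ} (h : 0 ≤ ρ) : 0 ≤ contractionRate ρ := by
  unfold contractionRate; positivity

lemma contractionRate_lt_one {ρ : ℝ} (h : ρ < 1) : contractionRate ρ < 1 := by
  unfold contractionRate
  rw [div_lt_one (by positivity)]
  nlinarith [sq_pos_of_pos (sub_pos.2 h)]

lemma one_add_sq_mul_norm_one_sub_le {C : ℂ} (hC : ‖C‖ ≤ 1) {s : ℝ} (h0 : 0 ≤ s) (h1 : s ≤ 1) :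
    (1 + s ^ 2) * ‖1 - C‖ ≤ 2 * ‖1 - (s : ℂ) ^ 2 * C‖ := by
  refine le_of_sq_le_sq ?_ (by positivity)
  rw [mul_pow, mul_pow, Complex.sq_norm, Complex.sq_norm]
  have hC2 : C.re ^ 2 + C.im ^ 2 ≤ 1 := by
    have : ‖C‖ ^ 2 ≤ 1 := by nlinarith [norm_nonneg C]
    rw [Complex.sq_norm, Complex.normSq_apply] at this
    linarith
  have hre : -1 ≤ C.re := by nlinarith [sq_nonneg C.im]
  have e : (s : ℂ) ^ 2 * C = ((s ^ 2 : ℝ) : ℂ) * C := by push_cast; ring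
  rw [e]
  simp only [Complex.normSq_apply, Complex.sub_re, Complex.sub_im, Complex.re_ofReal_mul,
    Complex.im_ofReal_mul, Complex.one_re, Complex.one_im]
  have hs : s ^ 2 ≤ 1 := by nlinarith
  -- The difference is affine and decreasing in `‖C‖ ^ 2`, with value
  -- `2 (1 - s²)² (1 + Re C)` at `‖C‖ = 1`.
  have k1 : 0 ≤ (1 - s ^ 2) ^ 2 * (1 + C.re) := mul_nonneg (sq_nonneg _) (by linarith)
  have k2 : 0 ≤ ((1 - s ^ 2) * (1 + 3 * s ^ 2)) * (1 - (C.re ^ 2 + C.im ^ 2)) :=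
    mul_nonneg (mul_nonneg (by linarith) (by positivity)) (by linarith)
  nlinarith [k1, k2]

lemma norm_mul_sub_mul_le {z a b : ℂ} {ρ c : ℝ} (hz : ‖z‖ ≤ ρ) (hρ : ρ < 1) (ha : ‖a‖ ≤ 1)
    (hb : ‖b‖ ≤ 1) (hc : 0 ≤ c) (h : ‖a - b‖ ≤ c * ‖1 - conj a * b‖) :
    ‖z * a - z * b‖ ≤ contractionRate ρ * c * ‖1 - conj (z * a) * (z * b)‖ := by
  have hz0 := norm_nonneg z
  have e : conj (z * a) * (z * b) = (‖z‖ : ℂ) ^ 2 * (conj a * b) := by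
    rw [← Complex.conj_mul' z, map_mul]; ring
  have hab : ‖conj a * b‖ ≤ 1 := by
    rw [norm_mul, Complex.norm_conj]
    exact mul_le_one₀ ha (norm_nonneg _) hb
  have key := one_add_sq_mul_norm_one_sub_le hab hz0 (hz.trans hρ.le)
  rw [← e] at key
  rw [← mul_sub, norm_mul]
  set X := ‖1 - conj a * b‖
  set Y := ‖1 - conj (z * a) * (z * b)‖
  have hY : 0 ≤ Y := norm_nonneg _
  have hq : ‖z‖ * X ≤ contractionRate ρ * Y := by
    have h1 : ‖z‖ * X ≤ contractionRate ‖z‖ * Y := by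
      unfold contractionRate
      rw [div_mul_eq_mul_div, le_div_iff₀ (by positivity)]
      nlinarith
    have h2 : contractionRate ‖z‖ ≤ contractionRate ρ := by
      unfold contractionRate
      rw [div_le_div_iff₀ (by positivity) (by positivity)]
      have : 0 ≤ (ρ - ‖z‖) * (1 - ρ * ‖z‖) :=
        mul_nonneg (by linarith) (by nlinarith)
      nlinarith
    exact h1.trans (mul_le_mul_of_nonneg_right h2 hY)
  calc ‖z‖ * ‖a - b‖ ≤ ‖z‖ * (c * X) := by gcongr
    _ = c * (‖z‖ * X) := by ring
    _ ≤ c * (contractionRate ρ * Y) := by gcongr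
    _ = _ := by ring

/-- Disc automorphisms preserve the pseudo-hyperbolic distance. -/
lemma norm_schurMap_sub_le {γ z a b : ℂ} {q : ℝ} (hγ : ‖γ‖ < 1) (hza : ‖z * a‖ < 1)
    (hzb : ‖z * b‖ < 1) (h : ‖z * a - z * b‖ ≤ q * ‖1 - conj (z * a) * (z * b)‖) :
    ‖schurMap γ z a - schurMap γ z b‖ ≤
      q * ‖1 - conj (schurMap γ z a) * schurMap γ z b‖ := by
  unfold schurMap
  generalize z * a = x at *
  generalize z * b = y at *
  have hx := one_add_conj_mul_ne_zero hγ hza.le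
  have hy := one_add_conj_mul_ne_zero hγ hzb.le
  have hx' : 1 + γ * conj x ≠ 0 := by
    simpa using (map_ne_zero (starRingEnd ℂ)).2 hx
  have e1 : (γ + x) / (1 + conj γ * x) - (γ + y) / (1 + conj γ * y) =
      (1 - conj γ * γ) * (x - y) / ((1 + conj γ * x) * (1 + conj γ * y)) := by
    rw [div_sub_div _ _ hx hy]; congr 1; ring
  have e2 : 1 - conj ((γ + x) / (1 + conj γ * x)) * ((γ + y) / (1 + conj γ * y)) =
      (1 - conj γ * γ) * (1 - conj x * y) / ((1 + γ * conj x) * (1 + conj γ * y)) := by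
    simp only [map_div₀, map_add, map_mul, map_one, Complex.conj_conj]
    rw [div_mul_div_comm, one_sub_div (mul_ne_zero hx' hy)]; congr 1; ring
  have e3 : ‖1 + γ * conj x‖ = ‖1 + conj γ * x‖ := by
    rw [← Complex.norm_conj]; simp
  rw [e1, e2, norm_div, norm_div, norm_mul, norm_mul, norm_mul, norm_mul, e3,
    ← mul_div_assoc, mul_left_comm q]
  gcongr

lemma norm_schurComp_sub_le_mul {γ : ℕ → ℂ} (hγ : ∀ n, ‖γ n‖ < 1) {z a b : ℂ} {ρ : ℝ}
    (hz : ‖z‖ ≤ ρ) (hρ : ρ < 1) (ha : ‖a‖ ≤ 1) (hb : ‖b‖ ≤ 1) (k n : ℕ) :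
    ‖schurComp γ z k n a - schurComp γ z k n b‖ ≤
      contractionRate ρ ^ n * ‖1 - conj (schurComp γ z k n a) * schurComp γ z k n b‖ := by
  have hz1 := hz.trans_lt hρ
  induction n generalizing k with
  | zero => simpa [schurComp] using norm_sub_le_norm_one_sub_conj_mul ha hb
  | succ n ih =>
    have hA := norm_schurComp_le_one hγ hz1 ha (k + 1) n
    have hB := norm_schurComp_le_one hγ hz1 hb (k + 1) n
    rw [pow_succ']
    exact norm_schurMap_sub_le (hγ k) (norm_mul_lt_one hz1 hA) (norm_mul_lt_one hz1 hB)
      (norm_mul_sub_mul_le hz hρ hA hB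
        (pow_nonneg (contractionRate_nonneg ((norm_nonneg z).trans hz)) n) (ih (k + 1)))

/-- The value of a Schur function is determined by its first `n` parameters up to an error that
is geometrically small in `n`, uniformly for `‖z‖ ≤ ρ`. -/
lemma norm_schurComp_sub_le {γ : ℕ → ℂ} (hγ : ∀ n, ‖γ n‖ < 1) {z a b : ℂ} {ρ : ℝ}
    (hz : ‖z‖ ≤ ρ) (hρ : ρ < 1) (ha : ‖a‖ ≤ 1) (hb : ‖b‖ ≤ 1) (k n : ℕ) :
    ‖schurComp γ z k n a - schurComp γ z k n b‖ ≤ 2 * contractionRate ρ ^ n := by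
  have hA := norm_schurComp_le_one hγ (hz.trans_lt hρ) ha k n
  have hB := norm_schurComp_le_one hγ (hz.trans_lt hρ) hb k n
  refine (norm_schurComp_sub_le_mul hγ hz hρ ha hb k n).trans ?_
  rw [mul_comm]
  gcongr
  · exact pow_nonneg (contractionRate_nonneg ((norm_nonneg z).trans hz)) n
  · refine (norm_sub_le _ _).trans ?_
    rw [norm_mul, Complex.norm_conj, norm_one]
    linarith [mul_le_one₀ hA (norm_nonneg _) hB]

/-! ### The parameters `δ`, `g`, `r` -/

lemma norm_delta {γ : ℕ → ℂ} (hγ : ∀ n, ‖γ n‖ < 1) (n : ℕ) : ‖delta γ n‖ = 1 := by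
  induction n with
  | zero => simp [delta]
  | succ n ih =>
    have h0 : 1 - γ n * delta γ n ≠ 0 :=
      one_sub_ne_zero_of_norm_lt_one (norm_mul_lt_one (hγ n) ih.le)
    rw [delta, norm_div, div_eq_one_iff_eq (norm_ne_zero_iff.2 h0)]
    have h := norm_one_sub_conj_mul_sq_sub (conj (γ n)) (delta γ n)
    rw [ih, Complex.conj_conj] at h
    exact (sq_eq_sq₀ (norm_nonneg _) (norm_nonneg _)).1 (by linarith)

lemma conj_delta_mul_delta {γ : ℕ → ℂ} (hγ : ∀ n, ‖γ n‖ < 1) (n : ℕ) :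
    conj (delta γ n) * delta γ n = 1 := by
  rw [Complex.conj_mul', norm_delta hγ]; simp

lemma re_pos_and_normSq_lt_of_norm_one_sub_lt {u : ℂ} (hu : ‖1 - u‖ < 1) :
    0 < u.re ∧ ‖u‖ ^ 2 < 2 * u.re := by
  have h : ‖1 - u‖ ^ 2 < 1 := by nlinarith [norm_nonneg (1 - u)]
  rw [Complex.sq_norm, Complex.normSq_apply] at h ⊢
  simp only [Complex.sub_re, Complex.sub_im, Complex.one_re, Complex.one_im] at h
  exact ⟨by nlinarith [mul_self_nonneg u.re, mul_self_nonneg u.im], by nlinarith⟩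

lemma norm_one_sub_one_sub_gamma_mul_delta_lt {γ : ℕ → ℂ} (hγ : ∀ n, ‖γ n‖ < 1) (n : ℕ) :
    ‖1 - (1 - γ n * delta γ n)‖ < 1 := by
  rw [sub_sub_cancel]
  exact norm_mul_lt_one (hγ n) (norm_delta hγ n).le

lemma wallG_succ_mem {γ : ℕ → ℂ} (hγ : ∀ n, ‖γ n‖ < 1) (n : ℕ) :
    0 < wallG γ (n + 1) ∧ wallG γ (n + 1) < 1 := by
  obtain ⟨h1, h2⟩ := re_pos_and_normSq_lt_of_norm_one_sub_lt
    (norm_one_sub_one_sub_gamma_mul_delta_lt hγ n)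
  have h0 : 1 - γ n * delta γ n ≠ 0 := fun h => by simp [h] at h1
  rw [wallG]
  exact ⟨div_pos (pow_pos (norm_pos_iff.2 h0) 2) (by linarith), by
    rwa [div_lt_one (by linarith)]⟩

lemma one_add_ofReal_mul_I_ne_zero (r : ℝ) : (1 : ℂ) + r * Complex.I ≠ 0 := by
  intro h; simpa using congrArg Complex.re h

lemma recoverU_eq (g r : ℕ → ℝ) (k : ℕ) :
    recoverU g r k = 2 * g (k + 1) / (1 + r (k + 1) * Complex.I) := by
  have h1 := one_add_ofReal_mul_I_ne_zero (r (k + 1))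
  have h2 := one_add_ofReal_mul_I_ne_zero (-r (k + 1))
  have e : (1 : ℂ) + (r (k + 1) : ℂ) ^ 2 =
      (1 + r (k + 1) * Complex.I) * (1 + (-r (k + 1) : ℝ) * Complex.I) := by
    push_cast; linear_combination (r (k + 1) : ℂ) ^ 2 * Complex.I_mul_I
  rw [recoverU, div_mul_eq_mul_div, ← sub_div, e, div_eq_div_iff (mul_ne_zero h1 h2) h1]
  push_cast; ring

lemma eq_two_mul_div_of_re_ne_zero {u : ℂ} (hu : u.re ≠ 0) :
    u = 2 * ((‖u‖ ^ 2 / (2 * u.re) : ℝ) : ℂ) / (1 + ((-(u.im / u.re) : ℝ) : ℂ) * Complex.I) := by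
  have hx : 2 * (‖u‖ ^ 2 / (2 * u.re)) * u.re = u.re * u.re + u.im * u.im := by
    rw [Complex.sq_norm, Complex.normSq_apply]; field_simp
  have hy : u.im / u.re * u.re = u.im := div_mul_cancel₀ _ hu
  rw [eq_div_iff (one_add_ofReal_mul_I_ne_zero _)]
  generalize ‖u‖ ^ 2 / (2 * u.re) = x at *
  generalize u.im / u.re = y at *
  apply Complex.ext
  · simp only [Complex.mul_re, Complex.mul_im, Complex.add_re, Complex.add_im, Complex.one_re,
      Complex.one_im, Complex.ofReal_re, Complex.ofReal_im, Complex.I_re, Complex.I_im,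
      Complex.re_ofNat, Complex.im_ofNat]
    apply mul_right_cancel₀ hu
    linear_combination u.im * hy - hx
  · simp only [Complex.mul_re, Complex.mul_im, Complex.add_re, Complex.add_im, Complex.one_re,
      Complex.one_im, Complex.ofReal_re, Complex.ofReal_im, Complex.I_re, Complex.I_im,
      Complex.re_ofNat, Complex.im_ofNat]
    linear_combination -hy

/-- The formula `u = 2 g / (1 + r i)`, equivalent to the definitions of `g` and `r`. -/
lemma one_sub_eq_recoverU {γ : ℕ → ℂ} (hγ : ∀ n, ‖γ n‖ < 1) (k : ℕ) :
    1 - γ k * delta γ k = recoverU (wallG γ) (wallR γ) k := by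
  rw [recoverU_eq, wallG, wallR]
  exact eq_two_mul_div_of_re_ne_zero
    (re_pos_and_normSq_lt_of_norm_one_sub_lt (norm_one_sub_one_sub_gamma_mul_delta_lt hγ k)).1.ne'

lemma delta_succ {γ : ℕ → ℂ} (hγ : ∀ n, ‖γ n‖ < 1) (n : ℕ) :
    delta γ (n + 1) =
      -(delta γ n * (conj (1 - γ n * delta γ n) / (1 - γ n * delta γ n))) := by
  rw [delta, ← mul_div_assoc, ← neg_div]
  congr 1
  simp only [map_sub, map_mul, map_one]
  linear_combination (-conj (γ n)) * conj_delta_mul_delta hγ n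

lemma delta_eq_prod {γ : ℕ → ℂ} (hγ : ∀ n, ‖γ n‖ < 1) (n : ℕ) :
    delta γ n = (-1) ^ n * ((∏ j ∈ Finset.range n, conj (1 - γ j * delta γ j)) /
      ∏ j ∈ Finset.range n, (1 - γ j * delta γ j)) := by
  induction n with
  | zero => simp [delta]
  | succ n ih =>
    rw [delta_succ hγ, Finset.prod_range_succ, Finset.prod_range_succ, pow_succ,
      mul_div_mul_comm]
    linear_combination (-(conj (1 - γ n * delta γ n) / (1 - γ n * delta γ n))) * ih

lemma recoveredFrom_wallG_wallR {γ : ℕ → ℂ} (hγ : ∀ n, ‖γ n‖ < 1) :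
    RecoveredFrom γ (wallG γ) (wallR γ) := by
  refine ⟨one_sub_eq_recoverU hγ, ?_, fun k => ?_⟩
  · rw [← one_sub_eq_recoverU hγ]; simp [delta]
  · simp only [← one_sub_eq_recoverU hγ]
    have h := congrArg conj (delta_eq_prod hγ (k + 1))
    simp only [map_mul, map_div₀, map_prod, map_pow, map_neg, map_one, Complex.conj_conj] at h
    have h2 : γ (k + 1) = conj (delta γ (k + 1)) *
        (1 - (1 - γ (k + 1) * delta γ (k + 1))) := by
      linear_combination (-γ (k + 1)) * conj_delta_mul_delta hγ (k + 1)
    exact h2.trans (by rw [h])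

/-! ### Approximants of continued fractions through their tails -/

lemma dens_succ_eq_prod (c : GenContFract ℂ) (p : ℕ → GenContFract.Pair ℂ)
    (hp : ∀ k, c.s.get? k = some (p k)) (t : ℕ → ℂ) (n : ℕ)
    (ht : ∀ k < n, t k * t (k + 1) = (p k).b * t (k + 1) + (p (k + 1)).a) :
    t n = (p n).b → c.dens (n + 1) = ∏ k ∈ Finset.range (n + 1), t k := by
  -- The telescoping identity that holds before the fraction is cut off.
  have key : ∀ m, (∀ k < m + 1, t k * t (k + 1) = (p k).b * t (k + 1) + (p (k + 1)).a) →
      t (m + 1) * c.dens (m + 1) + (p (m + 1)).a * c.dens m =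
        ∏ k ∈ Finset.range (m + 2), t k := by
    intro m
    induction m with
    | zero =>
      intro h
      rw [GenContFract.first_den_eq (hp 0), GenContFract.zeroth_den_eq_one,
        Finset.prod_range_succ, Finset.prod_range_one, h 0 (by simp)]
      ring
    | succ m ih =>
      intro h
      rw [GenContFract.dens_recurrence (hp (m + 1)) rfl rfl, Finset.prod_range_succ,
        ← ih fun k hk => h k (by omega)]
      linear_combination (-c.dens (m + 1)) * h (m + 1) (by omega)
  intro htn
  cases n with
  | zero => rw [GenContFract.first_den_eq (hp 0)]; simp [htn]
  | succ m => rw [GenContFract.dens_recurrence (hp (m + 1)) rfl rfl, ← htn, key m ht]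

lemma nums_succ_eq_prod (c : GenContFract ℂ) (hc : c.h = 0) (p : ℕ → GenContFract.Pair ℂ)
    (hp : ∀ k, c.s.get? k = some (p k)) (t : ℕ → ℂ) (n : ℕ)
    (ht : ∀ k < n, t k * t (k + 1) = (p k).b * t (k + 1) + (p (k + 1)).a) :
    t n = (p n).b → c.nums (n + 1) = (p 0).a * ∏ k ∈ Finset.range n, t (k + 1) := by
  have h1 : c.nums 1 = (p 0).a := by rw [GenContFract.first_num_eq (hp 0), hc]; simp
  have key : ∀ m, (∀ k < m + 1, t k * t (k + 1) = (p k).b * t (k + 1) + (p (k + 1)).a) →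
      t (m + 1) * c.nums (m + 1) + (p (m + 1)).a * c.nums m =
        (p 0).a * ∏ k ∈ Finset.range (m + 1), t (k + 1) := by
    intro m
    induction m with
    | zero =>
      intro h
      rw [h1, GenContFract.zeroth_num_eq_h, hc, Finset.prod_range_one]
      ring
    | succ m ih =>
      intro h
      rw [GenContFract.nums_recurrence (hp (m + 1)) rfl rfl, Finset.prod_range_succ, ← mul_assoc,
        ← ih fun k hk => h k (by omega)]
      linear_combination (-c.nums (m + 1)) * h (m + 1) (by omega)
  intro htn
  cases n with
  | zero => rw [h1]; simp
  | succ m => rw [GenContFract.nums_recurrence (hp (m + 1)) rfl rfl, ← htn, key m ht]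

/-- If the numbers `t k` satisfy `t k = b k + a (k + 1) / t (k + 1)` for `k < n` and `t n = b n`,
then they are the tails of the approximant cut off after the pair of index `n`. -/
lemma dens_ne_zero_and_convs_eq (c : GenContFract ℂ) (hc : c.h = 0)
    (p : ℕ → GenContFract.Pair ℂ) (hp : ∀ k, c.s.get? k = some (p k)) (t : ℕ → ℂ) (n : ℕ)
    (ht : ∀ k < n, t k * t (k + 1) = (p k).b * t (k + 1) + (p (k + 1)).a)
    (htn : t n = (p n).b) (h0 : ∀ k ≤ n, t k ≠ 0) :
    c.dens (n + 1) ≠ 0 ∧ c.convs (n + 1) = (p 0).a / t 0 := by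
  have hd := dens_succ_eq_prod c p hp t n ht htn
  have hprod : ∏ k ∈ Finset.range n, t (k + 1) ≠ 0 :=
    Finset.prod_ne_zero_iff.2 fun k hk => h0 _ (Finset.mem_range.1 hk)
  refine ⟨?_, ?_⟩
  · rw [hd]
    exact Finset.prod_ne_zero_iff.2 fun k hk => h0 k (Nat.lt_succ_iff.1 (Finset.mem_range.1 hk))
  · rw [GenContFract.conv_eq_num_div_den, hd, nums_succ_eq_prod c hc p hp t n ht htn,
      Finset.prod_range_succ', mul_comm (∏ k ∈ Finset.range n, t (k + 1)),
      mul_div_mul_right _ _ hprod]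

/-! ### The tails of Wall's fraction -/

/-- The tails of Wall's fraction, in terms of the values `h k = δ k * f_k z`. -/
def wallTail (g : ℕ → ℝ) (z : ℂ) (h : ℕ → ℂ) : ℕ → ℂ
  | 0 => Complex.I * (1 - z * h 0) / (1 + z * h 0)
  | k + 1 => 2 * Complex.I * g (k + 1) * (1 + z * h k) / ((1 + z) * (1 - h k))

lemma wallTail_zero_eq {z : ℂ} (h : ℂ) (hz : 1 + z ≠ 0) (hzh : 1 + z * h ≠ 0) :
    Complex.I * (1 - z * h) / (1 + z * h) =
      Complex.I * (1 - z) / (1 + z) +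
        2 * Complex.I * z * (1 - h) / ((1 + z) * (1 + z * h)) := by
  rw [div_add_div _ _ hz (mul_ne_zero hz hzh), div_eq_div_iff hzh
    (mul_ne_zero hz (mul_ne_zero hz hzh))]
  ring

lemma wallTail_succ_eq {z g r h h' : ℂ} (hg : g ≠ 0) (hz : 1 + z ≠ 0) (hzh : 1 + z * h' ≠ 0)
    (hh : h * (1 + r * Complex.I - (1 - r * Complex.I - 2 * g) * (z * h')) =
      1 + r * Complex.I - 2 * g - z * h' * (1 - r * Complex.I)) :
    2 * Complex.I * g * (1 + z * h) / ((1 + z) * (1 - h)) =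
      Complex.I * (1 - z) / (1 + z) - r +
        2 * Complex.I * z * (1 - g) * (1 - h') / ((1 + z) * (1 + z * h')) := by
  set N := 1 + r * Complex.I - (1 - r * Complex.I - 2 * g) * (z * h') with hNdef
  have h1 : (1 - h) * N = 2 * g * (1 + z * h') := by rw [sub_mul, hh, hNdef]; ring
  have h2 : (1 + z * h) * N = (1 + r * Complex.I) * (1 + z) - 2 * g * z -
      z * h' * ((1 - r * Complex.I) * (1 + z) - 2 * g) := by
    rw [add_mul, mul_assoc z, hh, hNdef]; ring
  have h3 : 2 * Complex.I * g * (1 + z * h) / ((1 + z) * (1 - h)) =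
      Complex.I * ((1 + r * Complex.I) * (1 + z) - 2 * g * z -
        z * h' * ((1 - r * Complex.I) * (1 + z) - 2 * g)) / ((1 + z) * (1 + z * h')) := by
    have h1ne : 1 - h ≠ 0 := by
      intro h0
      rw [h0, zero_mul] at h1
      exact mul_ne_zero (mul_ne_zero two_ne_zero hg) hzh h1.symm
    rw [div_eq_div_iff (mul_ne_zero hz h1ne) (mul_ne_zero hz hzh), ← h2]
    linear_combination (-(Complex.I * (1 + z * h) * (1 + z))) * h1
  have h4 : Complex.I * (1 - z) / (1 + z) - r =
      (Complex.I * (1 - z) - r * (1 + z)) * (1 + z * h') / ((1 + z) * (1 + z * h')) := by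
    rw [mul_div_mul_right _ _ hzh, sub_div, mul_div_cancel_right₀ _ hz]
  rw [h3, h4, ← add_div]
  congr 1
  linear_combination (r * (1 + z) * (1 + z * h')) * Complex.I_mul_I

lemma one_add_wallR_mul_I {γ : ℕ → ℂ} (hγ : ∀ n, ‖γ n‖ < 1) (k : ℕ) :
    (1 + wallR γ (k + 1) * Complex.I) * (1 - γ k * delta γ k) = 2 * wallG γ (k + 1) := by
  rw [one_sub_eq_recoverU hγ, recoverU_eq, mul_div_cancel₀ _ (one_add_ofReal_mul_I_ne_zero _)]

lemma one_sub_wallR_mul_I {γ : ℕ → ℂ} (hγ : ∀ n, ‖γ n‖ < 1) (k : ℕ) :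
    (1 - wallR γ (k + 1) * Complex.I) * (1 - conj (γ k) * conj (delta γ k)) =
      2 * wallG γ (k + 1) := by
  have h := congrArg conj (one_add_wallR_mul_I hγ k)
  simp only [map_mul, map_add, map_sub, map_one, Complex.conj_ofReal, Complex.conj_I,
    Complex.conj_ofNat] at h
  rw [← h]; ring

lemma one_sub_wallR_mul_delta_succ {γ : ℕ → ℂ} (hγ : ∀ n, ‖γ n‖ < 1) (k : ℕ) :
    (1 - wallR γ (k + 1) * Complex.I) * delta γ (k + 1) =
      -((1 + wallR γ (k + 1) * Complex.I) * delta γ k) := by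
  have h0 : 1 - γ k * delta γ k ≠ 0 :=
    one_sub_ne_zero_of_norm_lt_one (norm_mul_lt_one (hγ k) (norm_delta hγ k).le)
  have h1 := one_add_wallR_mul_I hγ k
  have h2 := one_sub_wallR_mul_I hγ k
  have h3 : delta γ (k + 1) * (1 - γ k * delta γ k) =
      -(delta γ k * (1 - conj (γ k) * conj (delta γ k))) := by
    rw [delta_succ hγ, neg_mul, mul_assoc, div_mul_cancel₀ _ h0]
    simp only [map_sub, map_mul, map_one]
  apply mul_right_cancel₀ h0
  linear_combination (1 - wallR γ (k + 1) * Complex.I) * h3 - delta γ k * h2 + delta γ k * h1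

/-- One Schur step, written for `h = δ_k f_k` and `h' = δ_{k+1} f_{k+1}` in terms of `g` and `r`. -/
lemma delta_mul_schurMap {γ : ℕ → ℂ} (hγ : ∀ n, ‖γ n‖ < 1) (k : ℕ) {z e : ℂ} (hz : ‖z‖ < 1)
    (he : ‖e‖ ≤ 1) {g r h' : ℂ} (hg : g = wallG γ (k + 1)) (hr : r = wallR γ (k + 1))
    (hh' : h' = delta γ (k + 1) * e) :
    delta γ k * schurMap (γ k) z e *
        (1 + r * Complex.I - (1 - r * Complex.I - 2 * g) * (z * h')) =
      1 + r * Complex.I - 2 * g - z * h' * (1 - r * Complex.I) := by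
  have h1 := one_add_wallR_mul_I hγ k
  have h2 := one_sub_wallR_mul_I hγ k
  have h3 := one_sub_wallR_mul_delta_succ hγ k
  have h4 := conj_delta_mul_delta hγ k
  have h6 := one_add_conj_mul_ne_zero (hγ k) (norm_mul_lt_one hz he).le
  rw [← hr] at h1 h2 h3
  rw [← hg] at h1 h2
  have hN : 1 + r * Complex.I - (1 - r * Complex.I - 2 * g) * (z * h') =
      (1 + r * Complex.I) * (1 + conj (γ k) * (z * e)) := by
    rw [hh']
    linear_combination (-(z * e * delta γ (k + 1))) * h2 -
      conj (γ k) * conj (delta γ k) * z * e * h3 +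
      conj (γ k) * z * e * (1 + r * Complex.I) * h4
  rw [hN, schurMap, hh']
  have h7 : (γ k + z * e) / (1 + conj (γ k) * (z * e)) * (1 + conj (γ k) * (z * e)) =
    γ k + z * e := div_mul_cancel₀ _ h6
  linear_combination delta γ k * (1 + r * Complex.I) * h7 - h1 + z * e * h3

lemma cayley_norm_lt_one {w : ℂ} (hw : w ∈ upperHalf) :
    Complex.I + w ≠ 0 ∧ ‖(Complex.I - w) / (Complex.I + w)‖ < 1 := by
  have hw' : 0 < w.im := hw
  have h0 : Complex.I + w ≠ 0 := by
    intro h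
    have := congrArg Complex.im h
    simp at this
    linarith
  refine ⟨h0, ?_⟩
  rw [norm_div, div_lt_one (norm_pos_iff.2 h0)]
  refine lt_of_pow_lt_pow_left₀ 2 (norm_nonneg _) ?_
  simp only [Complex.sq_norm, Complex.normSq_apply, Complex.sub_re, Complex.sub_im,
    Complex.add_re, Complex.add_im, Complex.I_re, Complex.I_im]
  nlinarith

/-- The approximant of index `n + 1` is the Cayley transform of the Carathéodory function whose
Schur algorithm terminates with the parameters `γ 0, …, γ (n - 1), conj (δ n)`. -/
lemma wallFraction_dens_convs {γ : ℕ → ℂ} (hγ : ∀ n, ‖γ n‖ < 1) {w z : ℂ} (hw : w ∈ upperHalf)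
    (hzw : z = (Complex.I - w) / (Complex.I + w)) (n : ℕ) :
    (wallFraction (wallG γ) (wallR γ) w).dens (n + 1) ≠ 0 ∧
      (wallFraction (wallG γ) (wallR γ) w).convs (n + 1) =
        Complex.I * (1 + z * schurComp γ z 0 n (conj (delta γ n))) /
          (1 - z * schurComp γ z 0 n (conj (delta γ n))) := by
  obtain ⟨hIw, hz⟩ := cayley_norm_lt_one hw
  rw [← hzw] at hz
  have h1z := one_add_ne_zero_of_norm_lt_one hz
  have hwz : w = Complex.I * (1 - z) / (1 + z) := by
    rw [eq_div_iff h1z, hzw]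
    field_simp
    ring
  have hw2 : w ^ 2 + 1 = 4 * z / (1 + z) ^ 2 := by
    rw [eq_div_iff (pow_ne_zero 2 h1z), hwz, div_pow, mul_pow, Complex.I_sq]
    field_simp
    ring
  have hconj : ‖conj (delta γ n)‖ ≤ 1 := by rw [Complex.norm_conj, norm_delta hγ]
  set e : ℕ → ℂ := fun k => schurComp γ z k (n - k) (conj (delta γ n)) with he
  set h : ℕ → ℂ := fun k => delta γ k * e k with hh
  have hen : e n = conj (delta γ n) := by simp [he, schurComp]
  have he1 : ∀ k, ‖e k‖ ≤ 1 := fun k => norm_schurComp_le_one hγ hz hconj _ _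
  have hestep : ∀ k < n, e k = schurMap (γ k) z (e (k + 1)) := by
    intro k hk
    obtain ⟨m, rfl⟩ := Nat.exists_eq_add_of_lt hk
    simp only [he]
    rw [show k + m + 1 - k = m + 1 by omega, show k + m + 1 - (k + 1) = m by omega, schurComp]
  have hh1 : ∀ k, ‖h k‖ ≤ 1 := by
    intro k; simp only [hh]; rw [norm_mul, norm_delta hγ, one_mul]; exact he1 k
  have hhlt : ∀ k < n, ‖h k‖ < 1 := by
    intro k hk
    simp only [hh]
    rw [norm_mul, norm_delta hγ, one_mul, hestep k hk]
    exact norm_schurMap_lt_one (hγ k) hz (he1 _)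
  have hhn : h n = 1 := by
    simp only [hh]; rw [hen, mul_comm]; exact conj_delta_mul_delta hγ n
  have hzh : ∀ k, 1 + z * h k ≠ 0 := fun k =>
    one_add_ne_zero_of_norm_lt_one (norm_mul_lt_one hz (hh1 k))
  have hzh' : ∀ k, 1 - z * h k ≠ 0 := fun k =>
    one_sub_ne_zero_of_norm_lt_one (norm_mul_lt_one hz (hh1 k))
  have hG : ∀ k, (wallG γ (k + 1) : ℂ) ≠ 0 := fun k => by
    exact_mod_cast (wallG_succ_mem hγ k).1.ne'
  have hI := Complex.I_ne_zero
  -- Since `wallG γ 0 = 0`, the formula is uniform in `k`.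
  have htail : ∀ k ≤ n, wallTail (wallG γ) z h k =
      (wallPair (wallG γ) (wallR γ) w k).b +
        2 * Complex.I * z * (1 - wallG γ k) * (1 - h k) / ((1 + z) * (1 + z * h k)) := by
    intro k hk
    cases k with
    | zero =>
      simp only [wallTail, wallPair, wallG]
      rw [wallTail_zero_eq _ h1z (hzh 0), ← hwz]
      simp
    | succ k =>
      have a2 := delta_mul_schurMap hγ k hz (he1 (k + 1)) rfl rfl rfl
      rw [← hestep k hk] at a2
      have a3 := wallTail_succ_eq (hG k) h1z (hzh (k + 1)) a2
      rw [← hwz] at a3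
      cases k <;> exact a3
  have hane : ∀ k, (wallPair (wallG γ) (wallR γ) w (k + 1)).a =
      -((1 - wallG γ k) * wallG γ (k + 1) * (w ^ 2 + 1)) := by
    intro k
    cases k with
    | zero => simp [wallPair, wallG]
    | succ k => rfl
  have hstep : ∀ k < n, wallTail (wallG γ) z h k * wallTail (wallG γ) z h (k + 1) =
      (wallPair (wallG γ) (wallR γ) w k).b * wallTail (wallG γ) z h (k + 1) +
        (wallPair (wallG γ) (wallR γ) w (k + 1)).a := by
    intro k hk
    have h1h := one_sub_ne_zero_of_norm_lt_one (hhlt k hk)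
    rw [htail k hk.le, add_mul, hane, hw2, wallTail]
    congr 1
    have := hzh k
    field_simp
    linear_combination (4 * z * wallG γ (k + 1) * (1 - wallG γ k)) * Complex.I_sq
  have hlast : wallTail (wallG γ) z h n = (wallPair (wallG γ) (wallR γ) w n).b := by
    rw [htail n le_rfl, hhn]; simp
  have hne : ∀ k ≤ n, wallTail (wallG γ) z h k ≠ 0 := by
    intro k hk
    cases k with
    | zero => exact div_ne_zero (mul_ne_zero hI (hzh' 0)) (hzh 0)
    | succ k =>
      exact div_ne_zero (mul_ne_zero (mul_ne_zero (mul_ne_zero two_ne_zero hI) (hG k)) (hzh k))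
        (mul_ne_zero h1z (one_sub_ne_zero_of_norm_lt_one (hhlt k hk)))
  obtain ⟨hd, hc⟩ := dens_ne_zero_and_convs_eq (wallFraction (wallG γ) (wallR γ) w) rfl
    (wallPair (wallG γ) (wallR γ) w) (fun _ => rfl) (wallTail (wallG γ) z h) n hstep hlast hne
  refine ⟨hd, ?_⟩
  have h00 : schurComp γ z 0 n (conj (delta γ n)) = h 0 := by simp [hh, he, delta]
  have b1 := hzh 0
  have b2 := hzh' 0
  rw [hc, h00, wallTail]
  simp only [wallPair]
  rw [div_div_eq_mul_div, div_eq_div_iff (mul_ne_zero hI b2) b2]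
  linear_combination (-((1 + z * h 0) * (1 - z * h 0))) * Complex.I_mul_I

/-! ### The Schur algorithm on the unit disc -/

/-- Schur functions: holomorphic on the unit disc and bounded there by `1`. -/
def IsSchur (f : ℂ → ℂ) : Prop :=
  DifferentiableOn ℂ f unitDisc ∧ ∀ z ∈ unitDisc, ‖f z‖ ≤ 1

lemma mem_unitDisc {z : ℂ} : z ∈ unitDisc ↔ ‖z‖ < 1 := mem_ball_zero_iff

lemma isOpen_unitDisc : IsOpen unitDisc := Metric.isOpen_ball

lemma zero_mem_unitDisc : (0 : ℂ) ∈ unitDisc := by simp [mem_unitDisc]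

/-- The Schwarz lemma: dividing by `z` preserves Schur functions vanishing at `0`. -/
lemma IsSchur.dslope {m : ℂ → ℂ} (hm : IsSchur m) (h0 : m 0 = 0) : IsSchur (dslope m 0) := by
  refine ⟨(Complex.differentiableOn_dslope
    (isOpen_unitDisc.mem_nhds zero_mem_unitDisc)).2 hm.1, fun z hz => ?_⟩
  have h := Complex.norm_dslope_le_div_of_mapsTo_ball (f := m) (c := 0) (R₁ := 1) (R₂ := 1) hm.1
    (fun x hx => by rw [h0]; exact mem_closedBall_zero_iff.2 (hm.2 x hx)) hz
  simpa using h

lemma mul_dslope_of_eq_zero {m : ℂ → ℂ} (h0 : m 0 = 0) (z : ℂ) : z * dslope m 0 z = m z := by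
  simpa [h0] using sub_smul_dslope m 0 z

lemma dslope_eqOn {m φ : ℂ → ℂ} (hφ : DifferentiableOn ℂ φ unitDisc)
    (h : ∀ z ∈ unitDisc, m z = z * φ z) : Set.EqOn (dslope m 0) φ unitDisc := by
  have h0 : m 0 = 0 := by simpa using h 0 zero_mem_unitDisc
  have hnhds := isOpen_unitDisc.mem_nhds zero_mem_unitDisc
  intro z hz
  by_cases hz0 : z = 0
  · subst hz0
    rw [dslope_same]
    have h1 : HasDerivAt (fun z => z * φ z) (1 * φ 0 + 0 * deriv φ 0) 0 :=
      (hasDerivAt_id (0 : ℂ)).mul (hφ.differentiableAt hnhds).hasDerivAt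
    have h2 : HasDerivAt m (1 * φ 0 + 0 * deriv φ 0) 0 :=
      h1.congr_of_eventuallyEq (Filter.eventually_of_mem hnhds h)
    simpa using h2.deriv
  · apply mul_left_cancel₀ hz0
    rw [mul_dslope_of_eq_zero h0, h z hz]

lemma differentiableOn_schurMap {γ : ℂ} (hγ : ‖γ‖ < 1) {φ : ℂ → ℂ} (hφ : IsSchur φ) :
    DifferentiableOn ℂ (fun z => schurMap γ z (φ z)) unitDisc := by
  have h : DifferentiableOn ℂ (fun z => z * φ z) unitDisc := differentiableOn_id.mul hφ.1
  exact (h.const_add γ).div ((h.const_mul (conj γ)).const_add 1) fun z hz =>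
    one_add_conj_mul_ne_zero hγ (norm_mul_lt_one (mem_unitDisc.1 hz) (hφ.2 z hz)).le

lemma norm_sub_div_one_sub_conj_mul_le {a b : ℂ} (ha : ‖a‖ < 1) (hb : ‖b‖ ≤ 1) :
    ‖(b - a) / (1 - conj a * b)‖ ≤ 1 := by
  rw [norm_div, norm_sub_rev]
  exact div_le_one_of_le₀ (norm_sub_le_norm_one_sub_conj_mul ha.le hb) (norm_nonneg _)

lemma IsSchur.schurStep {f : ℂ → ℂ} (hf : IsSchur f) (h0 : ‖f 0‖ < 1) :
    IsSchur (schurStep f) ∧ ∀ z ∈ unitDisc, f z = schurMap (f 0) z (schurStep f z) := by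
  have hden : ∀ z ∈ unitDisc, 1 - conj (f 0) * f z ≠ 0 := fun z hz =>
    one_sub_conj_mul_ne_zero h0 (hf.2 z hz)
  have hm : IsSchur (fun z => (f z - f 0) / (1 - conj (f 0) * f z)) :=
    ⟨(hf.1.sub_const _).div ((hf.1.const_mul _).const_sub 1) hden,
      fun z hz => norm_sub_div_one_sub_conj_mul_le h0 (hf.2 z hz)⟩
  have hm0 : (fun z => (f z - f 0) / (1 - conj (f 0) * f z)) 0 = 0 := by simp
  refine ⟨hm.dslope hm0, fun z hz => ?_⟩
  have h1 := hden z hz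
  have h2 := one_sub_conj_mul_ne_zero h0 h0.le
  rw [WallCF.schurStep, schurMap, mul_dslope_of_eq_zero hm0]
  have e1 : f 0 + (f z - f 0) / (1 - conj (f 0) * f z) =
      f z * (1 - conj (f 0) * f 0) / (1 - conj (f 0) * f z) := by
    rw [eq_div_iff h1, add_mul, div_mul_cancel₀ _ h1]; ring
  have e2 : 1 + conj (f 0) * ((f z - f 0) / (1 - conj (f 0) * f z)) =
      (1 - conj (f 0) * f 0) / (1 - conj (f 0) * f z) := by
    rw [eq_div_iff h1, add_mul, mul_assoc, div_mul_cancel₀ _ h1]; ring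
  rw [e1, e2, div_div_div_cancel_right₀ h1, mul_div_cancel_right₀ _ h2]

/-- The Schur step undoes `schurMap`. -/
lemma schurStep_eqOn {γ : ℂ} (hγ : ‖γ‖ < 1) {f φ : ℂ → ℂ} (hφ : IsSchur φ)
    (h : ∀ z ∈ unitDisc, f z = schurMap γ z (φ z)) : Set.EqOn (schurStep f) φ unitDisc := by
  have h0 : f 0 = γ := by rw [h 0 zero_mem_unitDisc]; simp [schurMap]
  refine dslope_eqOn hφ.1 fun z hz => ?_
  have h1 := one_add_conj_mul_ne_zero hγ (norm_mul_lt_one (mem_unitDisc.1 hz) (hφ.2 z hz)).le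
  have h2 := one_sub_conj_mul_ne_zero hγ hγ.le
  rw [h0, h z hz, schurMap]
  have e1 : (γ + z * φ z) / (1 + conj γ * (z * φ z)) - γ =
      z * φ z * (1 - conj γ * γ) / (1 + conj γ * (z * φ z)) := by
    rw [eq_div_iff h1, sub_mul, div_mul_cancel₀ _ h1]; ring
  have e2 : 1 - conj γ * ((γ + z * φ z) / (1 + conj γ * (z * φ z))) =
      (1 - conj γ * γ) / (1 + conj γ * (z * φ z)) := by
    rw [eq_div_iff h1, sub_mul, mul_assoc, div_mul_cancel₀ _ h1]; ring
  rw [e1, e2, div_div_div_cancel_right₀ h1, mul_div_cancel_right₀ _ h2]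

/-! ### Carathéodory functions and Schur functions -/

lemma add_one_ne_zero_of_re_pos {a : ℂ} (ha : 0 < a.re) : a + 1 ≠ 0 := by
  intro h
  have := congrArg Complex.re h
  simp at this
  linarith

lemma IsCaratheodory.schurFunction {F : ℂ → ℂ} (hF : IsCaratheodory F) :
    IsSchur (schurFunction F) ∧ ∀ z ∈ unitDisc,
      F z = (1 + z * schurFunction F z) / (1 - z * schurFunction F z) := by
  obtain ⟨hd, hF0, hre⟩ := hF
  have hne : ∀ z ∈ unitDisc, F z + 1 ≠ 0 := fun z hz => add_one_ne_zero_of_re_pos (hre z hz)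
  have hm : IsSchur (fun z => (F z - 1) / (F z + 1)) := by
    refine ⟨(hd.sub_const 1).div (hd.add_const 1) hne, fun z hz => ?_⟩
    rw [norm_div]
    refine div_le_one_of_le₀ (le_of_sq_le_sq ?_ (norm_nonneg _)) (norm_nonneg _)
    simp only [Complex.sq_norm, Complex.normSq_apply, Complex.sub_re, Complex.sub_im,
      Complex.add_re, Complex.add_im, Complex.one_re, Complex.one_im]
    nlinarith [hre z hz]
  have hm0 : (fun z => (F z - 1) / (F z + 1)) 0 = 0 := by simp [hF0]
  refine ⟨hm.dslope hm0, fun z hz => ?_⟩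
  have h1 := hne z hz
  rw [WallCF.schurFunction, mul_dslope_of_eq_zero hm0]
  have e1 : 1 + (F z - 1) / (F z + 1) = F z * 2 / (F z + 1) := by
    rw [eq_div_iff h1, add_mul, div_mul_cancel₀ _ h1]; ring
  have e2 : 1 - (F z - 1) / (F z + 1) = 2 / (F z + 1) := by
    rw [eq_div_iff h1, sub_mul, div_mul_cancel₀ _ h1]; ring
  rw [e1, e2, div_div_div_cancel_right₀ h1, mul_div_cancel_right₀ _ two_ne_zero]

lemma re_one_add_div_one_sub_pos {a : ℂ} (ha : ‖a‖ < 1) : 0 < ((1 + a) / (1 - a)).re := by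
  have h0 := Complex.normSq_pos.2 (one_sub_ne_zero_of_norm_lt_one ha)
  have h1 : ‖a‖ ^ 2 < 1 := by nlinarith [norm_nonneg a]
  rw [Complex.sq_norm, Complex.normSq_apply] at h1
  rw [Complex.div_re, ← add_div]
  refine div_pos ?_ h0
  simp only [Complex.sub_re, Complex.sub_im, Complex.add_re, Complex.add_im, Complex.one_re,
    Complex.one_im]
  nlinarith

lemma IsSchur.isCaratheodory {f : ℂ → ℂ} (hf : IsSchur f) :
    IsCaratheodory (fun z => (1 + z * f z) / (1 - z * f z)) ∧
      Set.EqOn (WallCF.schurFunction fun z => (1 + z * f z) / (1 - z * f z)) f unitDisc := by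
  have hlt : ∀ z ∈ unitDisc, ‖z * f z‖ < 1 := fun z hz =>
    norm_mul_lt_one (mem_unitDisc.1 hz) (hf.2 z hz)
  have hzf : DifferentiableOn ℂ (fun z => z * f z) unitDisc := differentiableOn_id.mul hf.1
  refine ⟨⟨(hzf.const_add 1).div (hzf.const_sub 1) fun z hz =>
    one_sub_ne_zero_of_norm_lt_one (hlt z hz), by simp,
    fun z hz => re_one_add_div_one_sub_pos (hlt z hz)⟩, ?_⟩
  refine dslope_eqOn hf.1 fun z hz => ?_
  have h1 := one_sub_ne_zero_of_norm_lt_one (hlt z hz)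
  have e1 : (1 + z * f z) / (1 - z * f z) - 1 = z * f z * 2 / (1 - z * f z) := by
    rw [eq_div_iff h1, sub_mul, div_mul_cancel₀ _ h1]; ring
  have e2 : (1 + z * f z) / (1 - z * f z) + 1 = 2 / (1 - z * f z) := by
    rw [eq_div_iff h1, add_mul, div_mul_cancel₀ _ h1]; ring
  rw [e1, e2, div_div_div_cancel_right₀ h1, mul_div_cancel_right₀ _ two_ne_zero]

lemma HasSchurParameters.isSchur_schurIterate {F : ℂ → ℂ} {γ : ℕ → ℂ} (hF : IsCaratheodory F)
    (h : HasSchurParameters F γ) (n : ℕ) : IsSchur (schurIterate (schurFunction F) n) := by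
  induction n with
  | zero => exact hF.schurFunction.1
  | succ n ih => exact (ih.schurStep (by rw [← (h n).2]; exact (h n).1)).1

lemma HasSchurParameters.schurIterate_eq_schurComp {F : ℂ → ℂ} {γ : ℕ → ℂ}
    (hF : IsCaratheodory F) (h : HasSchurParameters F γ) {z : ℂ} (hz : z ∈ unitDisc) (k n : ℕ) :
    schurIterate (schurFunction F) k z =
      schurComp γ z k n (schurIterate (schurFunction F) (k + n) z) := by
  induction n generalizing k with
  | zero => rfl
  | succ n ih =>
    have hk := ((h.isSchur_schurIterate hF k).schurStep (by rw [← (h k).2]; exact (h k).1)).2 z hz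
    rw [← (h k).2] at hk
    rw [hk, schurComp, show k + (n + 1) = k + 1 + n by ring, ← ih (k + 1)]
    rfl

/-! ### A Schur function with prescribed parameters -/

lemma dist_schurComp_succ_le {γ : ℕ → ℂ} (hγ : ∀ n, ‖γ n‖ < 1) {z : ℂ} {ρ : ℝ}
    (hz : ‖z‖ ≤ ρ) (hρ : ρ < 1) (k n : ℕ) :
    dist (schurComp γ z k n 0) (schurComp γ z k (n + 1) 0) ≤ 2 * contractionRate ρ ^ n := by
  rw [dist_eq_norm_sub, schurComp_succ_right]
  exact norm_schurComp_sub_le hγ hz hρ (by simp)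
    (norm_schurMap_lt_one (hγ _) (hz.trans_lt hρ) (by simp)).le k n

/-- The Schur function with parameters `γ k, γ (k + 1), …`: the limit of the functions with
parameters `γ k, …, γ (k + n - 1), 0, 0, …`. -/
def schurLimit (γ : ℕ → ℂ) (k : ℕ) (z : ℂ) : ℂ := limUnder atTop fun n => schurComp γ z k n 0

lemma tendsto_schurLimit {γ : ℕ → ℂ} (hγ : ∀ n, ‖γ n‖ < 1) {z : ℂ} (hz : z ∈ unitDisc) (k : ℕ) :
    Tendsto (fun n => schurComp γ z k n 0) atTop (𝓝 (schurLimit γ k z)) :=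
  (cauchySeq_of_le_geometric _ _ (contractionRate_lt_one (mem_unitDisc.1 hz))
    (dist_schurComp_succ_le hγ le_rfl (mem_unitDisc.1 hz) k)).tendsto_limUnder

lemma isSchur_schurComp {γ : ℕ → ℂ} (hγ : ∀ n, ‖γ n‖ < 1) (k n : ℕ) :
    IsSchur fun z => schurComp γ z k n 0 := by
  refine ⟨?_, fun z hz => norm_schurComp_le_one hγ (mem_unitDisc.1 hz) (by simp) k n⟩
  induction n generalizing k with
  | zero => exact differentiableOn_const 0
  | succ n ih =>
    exact differentiableOn_schurMap (hγ k) ⟨ih (k + 1), fun z hz =>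
      norm_schurComp_le_one hγ (mem_unitDisc.1 hz) (by simp) (k + 1) n⟩

lemma tendstoLocallyUniformlyOn_schurLimit {γ : ℕ → ℂ} (hγ : ∀ n, ‖γ n‖ < 1) (k : ℕ) :
    TendstoLocallyUniformlyOn (fun n z => schurComp γ z k n 0) (schurLimit γ k) atTop
      unitDisc := by
  rw [Metric.tendstoLocallyUniformlyOn_iff]
  intro ε hε x hx
  obtain ⟨ρ, hxρ, hρ⟩ := exists_between (mem_unitDisc.1 hx)
  have hq := contractionRate_lt_one hρ
  have hlim : Tendsto (fun n => 2 * contractionRate ρ ^ n / (1 - contractionRate ρ)) atTop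
      (𝓝 0) := by
    simpa using ((tendsto_pow_atTop_nhds_zero_of_lt_one (contractionRate_nonneg
      ((norm_nonneg x).trans hxρ.le)) hq).const_mul 2).div_const (1 - contractionRate ρ)
  refine ⟨Metric.ball 0 ρ, mem_nhdsWithin_of_mem_nhds
    (Metric.isOpen_ball.mem_nhds (mem_ball_zero_iff.2 hxρ)), ?_⟩
  filter_upwards [hlim.eventually (gt_mem_nhds hε)] with n hn y hy
  have hy' : ‖y‖ ≤ ρ := (mem_ball_zero_iff.1 hy).le
  rw [dist_comm]
  exact (dist_le_of_le_geometric_of_tendsto _ _ hq (dist_schurComp_succ_le hγ hy' hρ k)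
    (tendsto_schurLimit hγ (mem_unitDisc.2 (hy'.trans_lt hρ)) k) n).trans_lt hn

lemma isSchur_schurLimit {γ : ℕ → ℂ} (hγ : ∀ n, ‖γ n‖ < 1) (k : ℕ) :
    IsSchur (schurLimit γ k) :=
  ⟨(tendstoLocallyUniformlyOn_schurLimit hγ k).differentiableOn
    (Eventually.of_forall fun n => (isSchur_schurComp hγ k n).1) isOpen_unitDisc,
    fun z hz => le_of_tendsto (tendsto_schurLimit hγ hz k).norm
      (Eventually.of_forall fun n => (isSchur_schurComp hγ k n).2 z hz)⟩

lemma schurLimit_eq_schurMap {γ : ℕ → ℂ} (hγ : ∀ n, ‖γ n‖ < 1) (k : ℕ) {z : ℂ}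
    (hz : z ∈ unitDisc) : schurLimit γ k z = schurMap (γ k) z (schurLimit γ (k + 1) z) := by
  have h0 := one_add_conj_mul_ne_zero (hγ k) (norm_mul_lt_one (mem_unitDisc.1 hz)
    ((isSchur_schurLimit hγ (k + 1)).2 z hz)).le
  have h := (tendsto_schurLimit hγ hz (k + 1)).const_mul z
  refine tendsto_nhds_unique ((tendsto_schurLimit hγ hz k).comp (tendsto_add_atTop_nat 1)) ?_
  exact (h.const_add (γ k)).div ((h.const_mul (conj (γ k))).const_add 1) h0

/-- Every sequence in the open unit disc is the sequence of Schur parameters of a Carathéodory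
function. -/
lemma exists_hasSchurParameters {γ : ℕ → ℂ} (hγ : ∀ n, ‖γ n‖ < 1) :
    ∃ F, IsCaratheodory F ∧ HasSchurParameters F γ := by
  obtain ⟨hF, hS⟩ := (isSchur_schurLimit hγ 0).isCaratheodory
  refine ⟨_, hF, fun n => ⟨hγ n, ?_⟩⟩
  have key : ∀ n, Set.EqOn (schurIterate (schurFunction fun z =>
      (1 + z * schurLimit γ 0 z) / (1 - z * schurLimit γ 0 z)) n) (schurLimit γ n) unitDisc := by
    intro n
    induction n with
    | zero => exact hS
    | succ n ih =>
      exact schurStep_eqOn (hγ n) (isSchur_schurLimit hγ (n + 1)) fun z hz =>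
        (ih hz).trans (schurLimit_eq_schurMap hγ n hz)
  rw [key n zero_mem_unitDisc, schurLimit_eq_schurMap hγ n zero_mem_unitDisc]
  simp [schurMap]

/-! ### Convergence of Wall's fraction -/

lemma IsCaratheodory.isNevanlinna_cayley {F : ℂ → ℂ} (hF : IsCaratheodory F) :
    IsNevanlinna (cayley F) := by
  have hmaps : ∀ w ∈ upperHalf, (Complex.I - w) / (Complex.I + w) ∈ unitDisc := fun w hw =>
    mem_unitDisc.2 (cayley_norm_lt_one hw).2
  refine ⟨?_, fun w hw => ?_⟩
  · exact (hF.1.comp ((differentiableOn_id.const_sub _).div (differentiableOn_id.const_add _)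
      fun w hw => (cayley_norm_lt_one hw).1) hmaps).const_mul Complex.I
  · simpa [cayley] using hF.2.2 _ (hmaps w hw)

lemma norm_one_sub_ge {a b : ℂ} {ρ : ℝ} (ha : ‖a‖ ≤ ρ) (hb : ‖b‖ ≤ 1) : 1 - ρ ≤ ‖1 - a * b‖ := by
  have h1 := norm_sub_norm_le (1 : ℂ) (a * b)
  rw [norm_one, norm_mul] at h1
  nlinarith [norm_nonneg a, norm_nonneg b]

lemma norm_cayley_sub_le {z a b : ℂ} {ρ c : ℝ} (hz : ‖z‖ ≤ ρ) (hρ : ρ < 1) (ha : ‖a‖ ≤ 1)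
    (hb : ‖b‖ ≤ 1) (hab : ‖a - b‖ ≤ c) :
    ‖Complex.I * ((1 + z * a) / (1 - z * a)) - Complex.I * (1 + z * b) / (1 - z * b)‖ ≤
      2 * c / (1 - ρ) ^ 2 := by
  have hz1 := hz.trans_lt hρ
  have h1 := one_sub_ne_zero_of_norm_lt_one (norm_mul_lt_one hz1 ha)
  have h2 := one_sub_ne_zero_of_norm_lt_one (norm_mul_lt_one hz1 hb)
  have e : Complex.I * ((1 + z * a) / (1 - z * a)) - Complex.I * (1 + z * b) / (1 - z * b) =
      2 * Complex.I * z * (a - b) / ((1 - z * a) * (1 - z * b)) := by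
    rw [← mul_div_assoc, div_sub_div _ _ h1 h2]; congr 1; ring
  have g1 := norm_one_sub_ge hz ha
  have g2 := norm_one_sub_ge hz hb
  have hρ' : 0 < 1 - ρ := by linarith
  rw [e, norm_div, norm_mul, norm_mul, norm_mul, norm_mul, Complex.norm_I, Complex.norm_ofNat,
    mul_one, sq]
  refine div_le_div₀ (by linarith [(norm_nonneg _).trans hab]) ?_ (by positivity)
    (mul_le_mul g1 g2 hρ'.le (hρ'.le.trans g1))
  rw [mul_assoc]
  have : ‖z‖ * ‖a - b‖ ≤ 1 * c := mul_le_mul hz1.le hab (norm_nonneg _) zero_le_one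
  linarith

lemma HasSchurParameters.represents {F : ℂ → ℂ} {γ : ℕ → ℂ} (hF : IsCaratheodory F)
    (h : HasSchurParameters F γ) : Represents (wallG γ) (wallR γ) (cayley F) := by
  have hγ : ∀ n, ‖γ n‖ < 1 := fun n => (h n).1
  refine ⟨fun n w hw => ?_, ?_⟩
  · cases n with
    | zero => simp [GenContFract.zeroth_den_eq_one]
    | succ n => exact (wallFraction_dens_convs hγ hw rfl n).1
  rw [Metric.tendstoLocallyUniformlyOn_iff]
  intro ε hε x hx
  obtain ⟨hIx, hxlt⟩ := cayley_norm_lt_one hx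
  obtain ⟨ρ, hxρ, hρ⟩ := exists_between hxlt
  have hq := contractionRate_lt_one hρ
  have hlim : Tendsto (fun n => 2 * (2 * contractionRate ρ ^ n) / (1 - ρ) ^ 2) atTop (𝓝 0) := by
    simpa using (((tendsto_pow_atTop_nhds_zero_of_lt_one (contractionRate_nonneg
      ((norm_nonneg _).trans hxρ.le)) hq).const_mul 2).const_mul 2).div_const ((1 - ρ) ^ 2)
  have hcont : ContinuousAt (fun w => ‖(Complex.I - w) / (Complex.I + w)‖) x :=
    ((continuousAt_const.sub continuousAt_id).div (continuousAt_const.add continuousAt_id)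
      hIx).norm
  refine ⟨upperHalf ∩ {w | ‖(Complex.I - w) / (Complex.I + w)‖ < ρ},
    inter_mem_nhdsWithin _ (hcont.eventually (gt_mem_nhds hxρ)), ?_⟩
  obtain ⟨N, hN⟩ := eventually_atTop.1 (hlim.eventually (gt_mem_nhds hε))
  filter_upwards [eventually_ge_atTop (N + 1)] with n hn y hy
  obtain ⟨m, rfl⟩ : ∃ m, n = m + 1 := ⟨n - 1, by omega⟩
  have hz : ‖(Complex.I - y) / (Complex.I + y)‖ ≤ ρ := le_of_lt hy.2
  have hzD := mem_unitDisc.2 (hz.trans_lt hρ)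
  have hδ : ‖conj (delta γ m)‖ ≤ 1 := by rw [Complex.norm_conj, norm_delta hγ]
  rw [dist_eq_norm_sub, cayley, (wallFraction_dens_convs hγ hy.1 rfl m).2,
    hF.schurFunction.2 _ hzD]
  refine (norm_cayley_sub_le hz hρ (hF.schurFunction.1.2 _ hzD)
    (norm_schurComp_le_one hγ (hz.trans_lt hρ) hδ 0 m) ?_).trans_lt (hN m (by omega))
  have hcomp := h.schurIterate_eq_schurComp hF hzD 0 m
  rw [schurIterate] at hcomp
  rw [hcomp]
  exact norm_schurComp_sub_le hγ hz hρ ((h.isSchur_schurIterate hF _).2 _ hzD) hδ 0 m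

/-! ### Parameters from the coefficients of the fraction -/

/-- The parameters `δ` in terms of the numbers `u = 1 - γ δ`. -/
def deltaOf (u : ℕ → ℂ) (n : ℕ) : ℂ :=
  (-1) ^ n * ((∏ j ∈ Finset.range n, conj (u j)) / ∏ j ∈ Finset.range n, u j)

/-- The Schur parameters in terms of the numbers `u = 1 - γ δ`. -/
def gammaOf (u : ℕ → ℂ) (n : ℕ) : ℂ := conj (deltaOf u n) * (1 - u n)

lemma norm_deltaOf {u : ℕ → ℂ} (hu : ∀ n, u n ≠ 0) (n : ℕ) : ‖deltaOf u n‖ = 1 := by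
  have h : ∏ j ∈ Finset.range n, ‖u j‖ ≠ 0 :=
    Finset.prod_ne_zero_iff.2 fun j _ => norm_ne_zero_iff.2 (hu j)
  simp [deltaOf, norm_prod, div_self h]

lemma delta_gammaOf {u : ℕ → ℂ} (hu : ∀ n, u n ≠ 0) (n : ℕ) :
    delta (gammaOf u) n = deltaOf u n := by
  induction n with
  | zero => simp [delta, deltaOf]
  | succ n ih =>
    have hcd : conj (deltaOf u n) * deltaOf u n = 1 := by
      rw [Complex.conj_mul', norm_deltaOf hu]; simp
    have h1 : 1 - gammaOf u n * deltaOf u n = u n := by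
      rw [gammaOf]; linear_combination (-(1 - u n)) * hcd
    have h2 : conj (gammaOf u n) - deltaOf u n = -(deltaOf u n * conj (u n)) := by
      simp only [gammaOf, map_mul, map_sub, map_one, Complex.conj_conj]; ring
    rw [delta, ih, h1, h2, deltaOf, deltaOf, Finset.prod_range_succ, Finset.prod_range_succ,
      pow_succ, mul_div_mul_comm]
    ring

lemma one_sub_gammaOf_mul_delta {u : ℕ → ℂ} (hu : ∀ n, u n ≠ 0) (n : ℕ) :
    1 - gammaOf u n * delta (gammaOf u) n = u n := by
  have hcd : conj (deltaOf u n) * deltaOf u n = 1 := by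
    rw [Complex.conj_mul', norm_deltaOf hu]; simp
  rw [delta_gammaOf hu, gammaOf]
  linear_combination (-(1 - u n)) * hcd

lemma recoverU_re_im (g r : ℕ → ℝ) (k : ℕ) :
    (recoverU g r k).re = 2 * g (k + 1) / (1 + r (k + 1) ^ 2) ∧
      (recoverU g r k).im = -(2 * g (k + 1) * r (k + 1) / (1 + r (k + 1) ^ 2)) := by
  have e : recoverU g r k = ((2 * g (k + 1) / (1 + r (k + 1) ^ 2) : ℝ) : ℂ) -
      ((2 * g (k + 1) * r (k + 1) / (1 + r (k + 1) ^ 2) : ℝ) : ℂ) * Complex.I := by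
    rw [recoverU]; push_cast; rfl
  rw [e]
  refine ⟨?_, ?_⟩
  · rw [Complex.sub_re, Complex.re_ofReal_mul, Complex.ofReal_re]; simp
  · rw [Complex.sub_im, Complex.im_ofReal_mul, Complex.ofReal_im]; simp

lemma recoverU_normSq (g r : ℕ → ℝ) (k : ℕ) :
    ‖recoverU g r k‖ ^ 2 = g (k + 1) * (2 * (recoverU g r k).re) := by
  obtain ⟨h1, h2⟩ := recoverU_re_im g r k
  rw [Complex.sq_norm, Complex.normSq_apply, h1, h2]
  have : 1 + r (k + 1) ^ 2 ≠ 0 := by positivity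
  field_simp

lemma norm_one_sub_recoverU_lt {g r : ℕ → ℝ} {k : ℕ} (hre : 0 < (recoverU g r k).re)
    (hg : g (k + 1) < 1) : ‖1 - recoverU g r k‖ < 1 := by
  have h := recoverU_normSq g r k
  rw [← sq_lt_one_iff₀ (norm_nonneg _)]
  rw [Complex.sq_norm, Complex.normSq_apply] at h ⊢
  simp only [Complex.sub_re, Complex.sub_im, Complex.one_re, Complex.one_im]
  nlinarith

/-- Any `g`, `r` with `0 < g < 1` come from a sequence of Schur parameters. -/
lemma exists_wallG_wallR_eq {g r : ℕ → ℝ} (hg : ∀ k, 1 ≤ k → 0 < g k ∧ g k < 1) :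
    ∃ γ : ℕ → ℂ, (∀ n, ‖γ n‖ < 1) ∧ ∀ k, wallG γ (k + 1) = g (k + 1) ∧
      wallR γ (k + 1) = r (k + 1) := by
  have hre : ∀ k, 0 < (recoverU g r k).re := fun k => by
    have := (hg (k + 1) (by omega)).1
    rw [(recoverU_re_im g r k).1]; positivity
  have hu : ∀ k, recoverU g r k ≠ 0 := fun k h => by simpa [h] using hre k
  refine ⟨gammaOf (recoverU g r), fun n => ?_, fun k => ⟨?_, ?_⟩⟩
  · rw [gammaOf, norm_mul, Complex.norm_conj, norm_deltaOf hu, one_mul]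
    exact norm_one_sub_recoverU_lt (hre n) (hg (n + 1) (by omega)).2
  · rw [wallG, one_sub_gammaOf_mul_delta hu, recoverU_normSq,
      mul_div_cancel_right₀ _ (by linarith [hre k])]
  · have h0 := (hg (k + 1) (by omega)).1.ne'
    have h1 : 1 + r (k + 1) ^ 2 ≠ 0 := by positivity
    rw [wallR, one_sub_gammaOf_mul_delta hu, (recoverU_re_im g r k).1, (recoverU_re_im g r k).2]
    field_simp

lemma wallFraction_congr {g r g' r' : ℕ → ℝ}
    (h : ∀ k, g' (k + 1) = g (k + 1) ∧ r' (k + 1) = r (k + 1)) :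
    wallFraction g' r' = wallFraction g r := by
  funext w
  have : wallPair g' r' w = wallPair g r w := by
    funext k
    match k with
    | 0 => rfl
    | 1 => simp only [wallPair]; rw [(h 0).1, (h 0).2]
    | k + 2 => simp only [wallPair]; rw [(h k).1, (h (k + 1)).1, (h (k + 1)).2]
  rw [wallFraction, this]; rfl

lemma recoverU_congr {g r g' r' : ℕ → ℝ}
    (h : ∀ k, g' (k + 1) = g (k + 1) ∧ r' (k + 1) = r (k + 1)) : recoverU g' r' = recoverU g r := by
  funext k
  rw [recoverU, (h k).1, (h k).2]; rfl

end WallCF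

end

theorem mainTheorem1 :
    (∀ (F : ℂ → ℂ) (γ : ℕ → ℂ),
      WallCF.IsCaratheodory F → WallCF.HasSchurParameters F γ →
        WallCF.IsNevanlinna (WallCF.cayley F) ∧
        (∀ k : ℕ, 1 ≤ k → 0 < WallCF.wallG γ k ∧ WallCF.wallG γ k < 1) ∧
        WallCF.Represents (WallCF.wallG γ) (WallCF.wallR γ) (WallCF.cayley F) ∧
        WallCF.RecoveredFrom γ (WallCF.wallG γ) (WallCF.wallR γ)) ∧
    (∀ g r : ℕ → ℝ, (∀ k : ℕ, 1 ≤ k → 0 < g k ∧ g k < 1) →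
      ∃ φ : ℂ → ℂ,
        WallCF.IsNevanlinna φ ∧ φ Complex.I = Complex.I ∧ WallCF.Represents g r φ ∧
        ∃ (F : ℂ → ℂ) (γ : ℕ → ℂ),
          WallCF.IsCaratheodory F ∧
          (∀ w ∈ WallCF.upperHalf, φ w = WallCF.cayley F w) ∧
          WallCF.HasSchurParameters F γ ∧
          (∀ k : ℕ, 1 ≤ k → WallCF.wallG γ k = g k ∧ WallCF.wallR γ k = r k) ∧
          WallCF.RecoveredFrom γ g r) := by
  refine ⟨fun F γ hF h => ?_, fun g r hg => ?_⟩
  · have hγ : ∀ n, ‖γ n‖ < 1 := fun n => (h n).1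
    refine ⟨hF.isNevanlinna_cayley, fun k hk => ?_, h.represents hF,
      WallCF.recoveredFrom_wallG_wallR hγ⟩
    obtain ⟨m, rfl⟩ := Nat.exists_eq_add_of_le' hk
    exact WallCF.wallG_succ_mem hγ m
  · obtain ⟨γ, hγ, hgr⟩ := WallCF.exists_wallG_wallR_eq (r := r) hg
    obtain ⟨F, hF, h⟩ := WallCF.exists_hasSchurParameters hγ
    have hrep := h.represents hF
    have hrec := WallCF.recoveredFrom_wallG_wallR hγ
    rw [WallCF.Represents, WallCF.wallFraction_congr hgr] at hrep
    rw [WallCF.RecoveredFrom, WallCF.recoverU_congr hgr] at hrec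
    refine ⟨WallCF.cayley F, hF.isNevanlinna_cayley, ?_, hrep, F, γ, hF, fun _ _ => rfl, h,
      fun k hk => ?_, hrec⟩
    · simp [WallCF.cayley, hF.2.1]
    · obtain ⟨m, rfl⟩ := Nat.exists_eq_add_of_le' hk
      exact hgr m
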